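/- For $f:\{0,1\}^n\to\mathbb C$ put $\hat f(\xi)=\mathbb E_{x\sim\{0,1\}^n}[f(x)(-1)^{\langle\xi,x\rangle}]$ for $\xi\in\{0,1\}^n$, with $x$ uniform, let $\|\hat f\|_2=(\sum_\xi|\hat f(\xi)|^2)^{1/2}$, and let the degree of $f$ be the largest Hamming weight $|\xi|$ of a $\xi$ with $\hat f(\xi)\ne0$ (and $0$ if $f=0$). Write $\binom n{\le d}=\sum_{j=0}^d\binom nj$. There is a universal constant $C>0$ such that the following holds for all integers $n,d\ge0$, every real $\delta>0$, and every integer $m\ge0$ such that $$m\ \ge\ \frac{C\binom nd\log\binom nd}{\delta^2}\ \text{ and } d<n,\qquad\text{or}\qquad m\ \ge\ \frac{C\binom n{\le d}\log\binom n{\le d}}{\delta^2}.$$ Let $\rho=\frac1{4\cdot3^{2d}}-8\delta$ and let $x_1,\dots,x_m$ be independent uniformly random points of $\{0,1\}^n$. With probability at least $0.99$, for all functions $p:\{0,1\}^n\to\mathbb C$ of degree at most $d$ and all subsets $S\subseteq[m]$ with $|S|\le\rho m$ simultaneously, $$\sum_{i\in S}|p(x_i)|\le\Big(\frac12-\delta\Big)\sum_{i\in[m]}|p(x_i)|,$$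 $$\sum_{i\in S}|p(x_i)|+\delta m\,\mathbb E_{x\sim\{0,1\}^n}|p(x)|\le\sum_{i\in[m]\setminus S}|p(x_i)|,$$ $$\sum_{i\in S}|p(x_i)|+\delta\,3^{-d}\,m\,\|\hat p\|_2\le\sum_{i\in[m]\setminus S}|p(x_i)|.$$ -/

import Mathlib

open Finset MeasureTheory ProbabilityTheory
open scoped BigOperators

/-- The Boolean cube `{0,1}^n`. -/
abbrev Cube (n : ℕ) : Type := Fin n → Fin 2

/-- The character `χ_ξ(x) = (-1)^{⟨ξ, x⟩}`. -/
def cubeChar {n : ℕ} (ξ x : Cube n) : ℂ :=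
  (-1) ^ (∑ i, (ξ i : ℕ) * (x i : ℕ))

/-- The Fourier coefficient `E_x [f(x) χ_ξ(x)]`, with `x` uniform on the cube. -/
noncomputable def cubeFourier {n : ℕ} (f : Cube n → ℂ) (ξ : Cube n) : ℂ :=
  𝔼 x, f x * cubeChar ξ x

open Classical in
/-- The degree of `f`: the largest Hamming weight of a `ξ` whose Fourier coefficient is nonzero
(and `0` for `f = 0`). -/
noncomputable def cubeDegree {n : ℕ} (f : Cube n → ℂ) : ℕ :=
  (univ.filter fun ξ : Cube n => cubeFourier f ξ ≠ 0).sup fun ξ => hammingNorm ξ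

/-- `‖f̂‖₂`, the Euclidean norm of the vector of Fourier coefficients. -/
noncomputable def cubeFourierL2 {n : ℕ} (f : Cube n → ℂ) : ℝ :=
  Real.sqrt (∑ ξ, ‖cubeFourier f ξ‖ ^ 2)

/-- `binom(n, ≤ d)`, the number of characters of degree at most `d`. -/
def chooseLE (n d : ℕ) : ℕ := ∑ j ∈ range (d + 1), n.choose j

/-- The joint law of `m` independent uniformly random points of the cube. -/
noncomputable def samplePoints (n m : ℕ) : Measure (Fin m → Cube n) :=
  Measure.pi fun _ => uniformOn (Set.univ : Set (Cube n))

/-- The conclusion for the sample points `x₁, …, x_m`: the three inequalities hold for every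
function `p` of degree at most `d` and every set `S` of at most `ρ m` indices. -/
def IsEuclideanSection {n m : ℕ} (d : ℕ) (δ ρ : ℝ) (x : Fin m → Cube n) : Prop :=
  ∀ p : Cube n → ℂ, cubeDegree p ≤ d → ∀ S : Finset (Fin m), (S.card : ℝ) ≤ ρ * m →
    ∑ i ∈ S, ‖p (x i)‖ ≤ (1 / 2 - δ) * ∑ i, ‖p (x i)‖ ∧
    ∑ i ∈ S, ‖p (x i)‖ + δ * m * 𝔼 y, ‖p y‖ ≤ ∑ i ∈ Sᶜ, ‖p (x i)‖ ∧
    ∑ i ∈ S, ‖p (x i)‖ + δ * (3 ^ d)⁻¹ * m * cubeFourierL2 p ≤ ∑ i ∈ Sᶜ, ‖p (x i)‖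

/-! Normalize `‖p̂‖₂ = 1` and put `κ = 3⁻ᵈ`. Hypercontractivity gives `𝔼‖p‖⁴ ≤ 9ᵈ`, which together
with `𝔼‖p‖² = 1` forces `κ ≤ 𝔼‖p‖ ≤ 1` (`inv_pow_le_expect_norm`, `expect_norm_le_one`), while the
excess of `‖p‖` over `κ⁻¹` has mean at most `κ / 4` (`expect_truncated_le`). If the sample averages
of `‖p‖` and of this excess are within `δ / κ` of these means (from above only, for the excess), a
set `S` with `#S ≤ ρ m` carries at most `m (κ / 2 - 7 δ / κ)`: `κ⁻¹` per point, plus the total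
excess. The full sum is at least `m (κ - δ / κ)`, so `S` falls short of half with room to spare
(`sum_subset_bounds`).

The closeness must be uniform in `p`. Symmetrization and contraction replace a 1-Lipschitz function
of `p` by `p` itself with random fourth roots of unity as signs. That process is linear in `p̂`,
hence controlled by `N = chooseLE n d` random character sums of mean square `m`; the expected
supremum is at most `4 √(N m)` (`expect_ciSup_deviation_le`). Markov's inequality then needs only `m
9ᵈ δ² ≳ N`. The gain `9ᵈ` absorbs the loss in `N ≤ 4ᵈ binom(n, d)`, and the logarithm serves only
through a constant lower bound. -/

/-! ### Averages over products and powers of finite types -/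

lemma expect_prod {α β M : Type*} [Fintype α] [Fintype β] [AddCommMonoid M] [Module ℚ≥0 M]
    (F : α × β → M) : 𝔼 w, F w = 𝔼 a, 𝔼 b, F (a, b) := by
  rw [← univ_product_univ, expect_product]

lemma expect_fin_succ {α M : Type*} [Fintype α] [AddCommMonoid M] [Module ℚ≥0 M] (m : ℕ)
    (F : (Fin (m + 1) → α) → M) :
    𝔼 x, F x = 𝔼 a, 𝔼 x : Fin m → α, F (Fin.cons a x) := by
  rw [← expect_prod fun w : α × (Fin m → α) => F (Fin.cons w.1 w.2)]
  exact (Fintype.expect_equiv (Fin.consEquiv fun _ => α) _ _ fun _ => rfl).symm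

lemma expect_fin_zero {α M : Type*} [Fintype α] [AddCommMonoid M] [Module ℚ≥0 M]
    (F : (Fin 0 → α) → M) : 𝔼 x, F x = F Fin.elim0 := by
  rw [univ_unique, expect_singleton]
  exact congrArg F (Subsingleton.elim _ _)

lemma expect_fin_four (F : Fin 4 → ℝ) : 𝔼 k, F k = (F 0 + F 1 + F 2 + F 3) / 4 := by
  rw [Fintype.expect_eq_sum_div_card, Fin.sum_univ_four]
  simp

lemma expect_fin_two {M : Type*} [Field M] [CharZero M] (F : Fin 2 → M) :
    𝔼 k, F k = (F 0 + F 1) / 2 := by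
  rw [Fintype.expect_eq_sum_div_card, Fin.sum_univ_two]
  simp

/-! ### Symmetrization and contraction -/

lemma ciSup_expect_le {ι Ω : Type*} [Finite ι] [Nonempty ι] [Fintype Ω] (F : ι → Ω → ℝ) :
    ⨆ p, 𝔼 y, F p y ≤ 𝔼 y, ⨆ p, F p y :=
  ciSup_le fun p => expect_le_expect fun y _ =>
    le_ciSup (f := fun p => F p y) (Set.finite_range _).bddAbove p

/-- A random fourth root of unity dominates an increment of a family in `ℂ`. -/
lemma norm_sub_add_half_le {ι : Type*} [Finite ι] (b : ι → ℂ) (g : ι → ℝ) (p q : ι) :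
    ‖b p - b q‖ + (g p + g q) / 2 ≤
      𝔼 k : Fin 4, ⨆ p, (4 * (Complex.I ^ (k : ℕ) * b p).re + g p) := by
  have key (k : Fin 4) (p : ι) : 4 * (Complex.I ^ (k : ℕ) * b p).re + g p ≤
      ⨆ p, (4 * (Complex.I ^ (k : ℕ) * b p).re + g p) :=
    le_ciSup (f := fun p => 4 * (Complex.I ^ (k : ℕ) * b p).re + g p)
      (Set.finite_range _).bddAbove p
  rw [expect_fin_four]
  have hn : ‖b p - b q‖ ≤ |(b p).re - (b q).re| + |(b p).im - (b q).im| := by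
    simpa using Complex.norm_le_abs_re_add_abs_im (b p - b q)
  have h0p := key 0 p
  have h0q := key 0 q
  have h1p := key 1 p
  have h1q := key 1 q
  have h2p := key 2 p
  have h2q := key 2 q
  have h3p := key 3 p
  have h3q := key 3 q
  simp only [Fin.val_zero, Fin.val_one, Fin.val_two, show ((3 : Fin 4) : ℕ) = 3 from rfl, pow_zero,
    pow_one, Complex.I_sq, Complex.I_pow_three, one_mul, neg_mul, Complex.neg_re, Complex.I_mul_re]
    at h0p h0q h1p h1q h2p h2q h3p h3q ⊢
  rcases abs_cases ((b p).re - (b q).re) with ⟨h, -⟩ | ⟨h, -⟩ <;>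
  rcases abs_cases ((b p).im - (b q).im) with ⟨h', -⟩ | ⟨h', -⟩ <;>
  linarith

/-- One coordinate of the symmetrization and contraction argument. -/
lemma expect_ciSup_centered_le {ι Ω : Type*} [Finite ι] [Nonempty ι] [Fintype Ω] [Nonempty Ω]
    (a : ι → Ω → ℂ) {ψ : ℂ → ℝ} (hψ : ∀ z w, ψ z - ψ w ≤ ‖z - w‖) (g : ι → ℝ) :
    𝔼 x, ⨆ p, (ψ (a p x) - 𝔼 y, ψ (a p y) + g p) ≤
      𝔼 x, 𝔼 k : Fin 4, ⨆ p, (4 * (Complex.I ^ (k : ℕ) * a p x).re + g p) := by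
  set A : Ω → ℝ := fun x => 𝔼 k : Fin 4, ⨆ p, (4 * (Complex.I ^ (k : ℕ) * a p x).re + g p)
  set D : Ω → Ω → ℝ := fun x y => ⨆ p, (ψ (a p x) - ψ (a p y) + g p) with hD
  have hstep : 𝔼 x, ⨆ p, (ψ (a p x) - 𝔼 y, ψ (a p y) + g p) ≤ 𝔼 x, 𝔼 y, D x y := by
    refine expect_le_expect fun x _ => le_trans (le_of_eq ?_) (ciSup_expect_le _)
    congr 1
    ext p
    rw [expect_add_distrib, expect_sub_distrib, Fintype.expect_const, Fintype.expect_const]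
  -- With maximizers `p` and `q` of the two suprema, the four `ψ` terms are regrouped by sample
  -- point instead of by index. The Lipschitz bound then applies at each point, so symmetrization
  -- and contraction happen together.
  have hpair (x y : Ω) : D x y + D y x ≤ A x + A y := by
    obtain ⟨p, hp⟩ := exists_eq_ciSup_of_finite (f := fun p => ψ (a p x) - ψ (a p y) + g p)
    obtain ⟨q, hq⟩ := exists_eq_ciSup_of_finite (f := fun p => ψ (a p y) - ψ (a p x) + g p)
    have h1 := norm_sub_add_half_le (fun p => a p x) g p q
    have h2 := norm_sub_add_half_le (fun p => a p y) g q p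
    have h3 := hψ (a p x) (a q x)
    have h4 := hψ (a q y) (a p y)
    simp only [hD, ← hp, ← hq]
    simp only [A]
    linarith
  have hsum : 𝔼 x, 𝔼 y, (D x y + D y x) ≤ 𝔼 x, 𝔼 y, (A x + A y) :=
    expect_le_expect fun x _ => expect_le_expect fun y _ => hpair x y
  simp only [expect_add_distrib, Fintype.expect_const] at hsum
  rw [expect_comm univ univ fun x y => D y x] at hsum
  linarith

/-- Coordinates are exchanged one at a time; the arbitrary offset `g` absorbs the terms of all the
others. -/
lemma expect_ciSup_sum_centered_le {ι Ω : Type*} [Finite ι] [Nonempty ι] [Fintype Ω] [Nonempty Ω]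
    (a : ι → Ω → ℂ) {ψ : ℂ → ℝ} (hψ : ∀ z w, ψ z - ψ w ≤ ‖z - w‖) (m : ℕ) (g : ι → ℝ) :
    𝔼 x : Fin m → Ω, ⨆ p, (∑ i, (ψ (a p (x i)) - 𝔼 y, ψ (a p y)) + g p) ≤
      𝔼 w : Fin m → Ω × Fin 4,
        ⨆ p, (∑ i, 4 * (Complex.I ^ ((w i).2 : ℕ) * a p (w i).1).re + g p) := by
  induction m generalizing g with
  | zero => simp
  | succ m ih =>
    rw [expect_fin_succ, expect_fin_succ]
    simp only [Fin.sum_univ_succ, Fin.cons_zero, Fin.cons_succ]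
    calc
      _ = 𝔼 b, 𝔼 x : Fin m → Ω, ⨆ p, (∑ i, (ψ (a p (x i)) - 𝔼 y, ψ (a p y)) +
            (ψ (a p b) - 𝔼 y, ψ (a p y) + g p)) := by
        refine expect_congr rfl fun b _ => expect_congr rfl fun x _ => ?_
        congr 1; ext p; ring
      _ ≤ 𝔼 b, 𝔼 w : Fin m → Ω × Fin 4,
            ⨆ p, (∑ i, 4 * (Complex.I ^ ((w i).2 : ℕ) * a p (w i).1).re +
              (ψ (a p b) - 𝔼 y, ψ (a p y) + g p)) :=
        expect_le_expect fun b _ => ih _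
      _ = 𝔼 w : Fin m → Ω × Fin 4, 𝔼 b,
            ⨆ p, ((ψ (a p b) - 𝔼 y, ψ (a p y)) +
              (∑ i, 4 * (Complex.I ^ ((w i).2 : ℕ) * a p (w i).1).re + g p)) := by
        rw [expect_comm]
        refine expect_congr rfl fun b _ => expect_congr rfl fun x _ => ?_
        congr 1; ext p; ring
      _ ≤ 𝔼 w : Fin m → Ω × Fin 4, 𝔼 b, 𝔼 k : Fin 4,
            ⨆ p, (4 * (Complex.I ^ (k : ℕ) * a p b).re +
              (∑ i, 4 * (Complex.I ^ ((w i).2 : ℕ) * a p (w i).1).re + g p)) :=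
        expect_le_expect fun w _ => expect_ciSup_centered_le a hψ _
      _ = _ := by
        rw [expect_comm, expect_prod]
        refine expect_congr rfl fun b _ => ?_
        rw [expect_comm]
        refine expect_congr rfl fun k _ => expect_congr rfl fun w _ => ?_
        congr 1; ext p; ring

/-- Cross terms vanish because the fourth roots of unity average to zero. The shift `z` makes the
induction close. -/
lemma expect_norm_sq_sum_phase {Ω : Type*} [Fintype Ω] [Nonempty Ω] {χ : Ω → ℂ}
    (hχ : ∀ x, ‖χ x‖ = 1) (m : ℕ) (z : ℂ) :
    𝔼 w : Fin m → Ω × Fin 4, ‖∑ i, Complex.I ^ ((w i).2 : ℕ) * χ (w i).1 + z‖ ^ 2 =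
      m + ‖z‖ ^ 2 := by
  induction m generalizing z with
  | zero => simp
  | succ m ih =>
    rw [expect_fin_succ]
    simp only [Fin.sum_univ_succ, Fin.cons_zero, Fin.cons_succ]
    have h (b : Ω × Fin 4) : 𝔼 w : Fin m → Ω × Fin 4, ‖Complex.I ^ (b.2 : ℕ) * χ b.1 +
        ∑ i, Complex.I ^ ((w i).2 : ℕ) * χ (w i).1 + z‖ ^ 2 =
        m + ‖Complex.I ^ (b.2 : ℕ) * χ b.1 + z‖ ^ 2 := by
      rw [← ih]
      refine expect_congr rfl fun w _ => ?_
      congr 2; ring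
    have h1 (x : Ω) : 𝔼 k : Fin 4, ‖Complex.I ^ (k : ℕ) * χ x + z‖ ^ 2 = 1 + ‖z‖ ^ 2 := by
      have h2 := congrArg (· ^ 2) (hχ x)
      rw [expect_fin_four]
      simp only [← Complex.normSq_eq_norm_sq, Complex.normSq_apply, Fin.val_zero, Fin.val_one,
        Fin.val_two, show ((3 : Fin 4) : ℕ) = 3 from rfl, pow_zero, pow_one, Complex.I_sq,
        Complex.I_pow_three, one_mul, neg_mul, Complex.neg_re, Complex.neg_im, Complex.I_mul_re,
        Complex.I_mul_im, Complex.add_re, Complex.add_im] at h2 ⊢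
      linarith
    simp_rw [h]
    rw [expect_add_distrib, Fintype.expect_const, expect_prod]
    simp_rw [h1]
    rw [Fintype.expect_const]
    push_cast; ring

/-! ### Characters of the cube -/

lemma cubeChar_cons {n : ℕ} (a b : Fin 2) (ξ x : Cube n) :
    cubeChar (Fin.cons a ξ : Cube (n + 1)) (Fin.cons b x : Cube (n + 1)) =
      (-1) ^ ((a : ℕ) * b) * cubeChar ξ x := by
  simp [cubeChar, Fin.sum_univ_succ, pow_add]

lemma norm_cubeChar {n : ℕ} (ξ x : Cube n) : ‖cubeChar ξ x‖ = 1 := by simp [cubeChar]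

lemma sum_cubeChar_mul {n : ℕ} (x y : Cube n) :
    ∑ ξ, cubeChar ξ x * cubeChar ξ y = if x = y then (2 : ℂ) ^ n else 0 := by
  have h : ∀ ξ : Cube n, cubeChar ξ x * cubeChar ξ y =
      ∏ i, (-1 : ℂ) ^ ((ξ i : ℕ) * (x i) + (ξ i : ℕ) * (y i)) := fun ξ => by
    rw [cubeChar, cubeChar, ← pow_add, ← sum_add_distrib, prod_pow_eq_pow_sum]
  have h1 (i : Fin n) : ∑ k : Fin 2, (-1 : ℂ) ^ ((k : ℕ) * (x i) + (k : ℕ) * (y i)) =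
      if x i = y i then 2 else 0 := by
    generalize x i = u; generalize y i = v
    fin_cases u <;> fin_cases v <;> norm_num
  simp_rw [h]
  rw [← Fintype.piFinset_univ, ← prod_univ_sum (fun _ => univ)
    fun i (k : Fin 2) => (-1 : ℂ) ^ ((k : ℕ) * (x i) + (k : ℕ) * (y i))]
  simp_rw [h1]
  split_ifs with hxy
  · simp [hxy]
  · obtain ⟨i, hi⟩ := Function.ne_iff.1 hxy
    exact prod_eq_zero (mem_univ i) (by simp [hi])

lemma sum_cubeFourier_mul_cubeChar {n : ℕ} (p : Cube n → ℂ) (x : Cube n) :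
    ∑ ξ, cubeFourier p ξ * cubeChar ξ x = p x := by
  simp only [cubeFourier, Fintype.expect_eq_sum_div_card, div_mul_eq_mul_div, sum_mul]
  rw [← sum_div, sum_comm]
  simp only [mul_assoc, ← mul_sum, sum_cubeChar_mul]
  simp

lemma cubeFourier_smul {n : ℕ} (c : ℂ) (p : Cube n → ℂ) (ξ : Cube n) :
    cubeFourier (fun x => c * p x) ξ = c * cubeFourier p ξ := by
  simp only [cubeFourier, mul_assoc, ← mul_expect]

lemma cubeDegree_le_iff {n d : ℕ} {p : Cube n → ℂ} :
    cubeDegree p ≤ d ↔ ∀ ξ, d < hammingNorm ξ → cubeFourier p ξ = 0 := by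
  simp only [cubeDegree, Finset.sup_le_iff, mem_filter, mem_univ, true_and]
  exact forall_congr' fun ξ => ⟨fun h hd => by_contra fun h0 => hd.not_ge (h h0),
    fun h h0 => not_lt.1 fun hd => h0 (h hd)⟩

/-! ### Parseval and hypercontractivity, by induction on the dimension -/

lemma sum_fin_succ {α M : Type*} [Fintype α] [AddCommMonoid M] (m : ℕ)
    (F : (Fin (m + 1) → α) → M) :
    ∑ x, F x = ∑ a, ∑ x : Fin m → α, F (Fin.cons a x) := by
  rw [← Fintype.sum_prod_type' fun (a : α) (x : Fin m → α) => F (Fin.cons a x)]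
  exact (Fintype.sum_equiv (Fin.consEquiv fun _ => α) _ _ fun _ => rfl).symm

lemma hammingNorm_cons {n : ℕ} (a : Fin 2) (ξ : Cube n) :
    hammingNorm (Fin.cons a ξ : Cube (n + 1)) = a + hammingNorm ξ := by
  simp only [hammingNorm, card_filter, Fin.sum_univ_succ, Fin.cons_zero, Fin.cons_succ]
  congr 1
  fin_cases a <;> simp

lemma sq_norm_add_sub (z w : ℂ) :
    (‖z + w‖ ^ 2 + ‖z - w‖ ^ 2) / 2 = ‖z‖ ^ 2 + ‖w‖ ^ 2 := by
  have := parallelogram_law_with_norm ℝ z w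
  linarith

lemma pow_four_norm_add_sub_le (z w : ℂ) :
    (‖z + w‖ ^ 4 + ‖z - w‖ ^ 4) / 2 ≤ ‖z‖ ^ 4 + 6 * (‖z‖ ^ 2 * ‖w‖ ^ 2) + ‖w‖ ^ 4 := by
  simp only [show ∀ u : ℂ, ‖u‖ ^ 4 = (‖u‖ ^ 2) ^ 2 from fun u => by ring,
    ← Complex.normSq_eq_norm_sq, Complex.normSq_apply, Complex.add_re, Complex.add_im,
    Complex.sub_re, Complex.sub_im]
  -- The slack is a multiple of `‖z‖²‖w‖² - Re(z w̄)² = Im(z w̄)²`.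
  nlinarith [sq_nonneg (z.re * w.im - z.im * w.re)]

/-- The second and fourth moments of a function with given Fourier coefficients: Parseval's
identity and the `(4, 2)` hypercontractive inequality. -/
lemma expect_norm_sum_cubeChar {n : ℕ} (c : Cube n → ℂ) :
    𝔼 x, ‖∑ ξ, c ξ * cubeChar ξ x‖ ^ 2 = ∑ ξ, ‖c ξ‖ ^ 2 ∧
      𝔼 x, ‖∑ ξ, c ξ * cubeChar ξ x‖ ^ 4 ≤ (∑ ξ, 3 ^ hammingNorm ξ * ‖c ξ‖ ^ 2) ^ 2 := by
  induction n with
  | zero =>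
    rw [expect_fin_zero, expect_fin_zero]
    simp only [univ_unique, sum_singleton, norm_mul, norm_cubeChar, mul_one, true_and]
    simp only [hammingNorm, univ_eq_empty, filter_empty, card_empty, pow_zero, one_mul, ← pow_mul]
    exact le_rfl
  | succ n ih =>
    set g : Cube n → ℂ := fun x => ∑ ξ, c (Fin.cons 0 ξ) * cubeChar ξ x with hg
    set h : Cube n → ℂ := fun x => ∑ ξ, c (Fin.cons 1 ξ) * cubeChar ξ x with hh
    obtain ⟨g2, g4⟩ := ih fun ξ => c (Fin.cons 0 ξ)
    obtain ⟨h2, h4⟩ := ih fun ξ => c (Fin.cons 1 ξ)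
    set G := ∑ ξ : Cube n, 3 ^ hammingNorm ξ * ‖c (Fin.cons 0 ξ)‖ ^ 2
    set H := ∑ ξ : Cube n, 3 ^ hammingNorm ξ * ‖c (Fin.cons 1 ξ)‖ ^ 2
    have hG : 0 ≤ G := sum_nonneg fun _ _ => by positivity
    have hH : 0 ≤ H := sum_nonneg fun _ _ => by positivity
    have hv0 (x : Cube n) : ∑ ξ, c ξ * cubeChar ξ (Fin.cons 0 x : Cube (n + 1)) = g x + h x := by
      rw [sum_fin_succ, Fin.sum_univ_two]
      simp [cubeChar_cons, hg, hh]
    have hv1 (x : Cube n) : ∑ ξ, c ξ * cubeChar ξ (Fin.cons 1 x : Cube (n + 1)) = g x - h x := by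
      rw [sum_fin_succ, Fin.sum_univ_two]
      simp [cubeChar_cons, hg, hh, sub_eq_add_neg]
    have hsplit (k : ℕ) : 𝔼 x, ‖∑ ξ, c ξ * cubeChar ξ x‖ ^ k =
        𝔼 x, (‖g x + h x‖ ^ k + ‖g x - h x‖ ^ k) / 2 := by
      rw [expect_fin_succ, expect_fin_two, ← expect_div, expect_add_distrib]
      simp only [hv0, hv1]
    rw [hsplit, hsplit]
    constructor
    · simp only [sq_norm_add_sub]
      rw [expect_add_distrib, sum_fin_succ, Fin.sum_univ_two, g2, h2]
    -- Cauchy–Schwarz reduces the mixed moment to the two fourth moments; then `G² + 6GH + H² ≤ (G +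
    -- 3H)²`.
    · have hmix : 𝔼 x, ‖g x‖ ^ 2 * ‖h x‖ ^ 2 ≤ G * H := by
        refine le_of_sq_le_sq ?_ (by positivity)
        calc (𝔼 x, ‖g x‖ ^ 2 * ‖h x‖ ^ 2) ^ 2
            ≤ (𝔼 x, (‖g x‖ ^ 2) ^ 2) * 𝔼 x, (‖h x‖ ^ 2) ^ 2 := expect_mul_sq_le_sq_mul_sq _ _ _
          _ ≤ G ^ 2 * H ^ 2 := by
            simp only [← pow_mul]
            exact mul_le_mul g4 h4 (expect_nonneg fun _ _ => by positivity) (by positivity)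
          _ = (G * H) ^ 2 := by ring
      have hGH : ∑ ξ : Cube (n + 1), 3 ^ hammingNorm ξ * ‖c ξ‖ ^ 2 = G + 3 * H := by
        rw [sum_fin_succ, Fin.sum_univ_two, mul_sum]
        simp [hammingNorm_cons, pow_add, mul_assoc, G]
      rw [hGH]
      calc 𝔼 x, (‖g x + h x‖ ^ 4 + ‖g x - h x‖ ^ 4) / 2
          ≤ 𝔼 x, (‖g x‖ ^ 4 + 6 * (‖g x‖ ^ 2 * ‖h x‖ ^ 2) + ‖h x‖ ^ 4) :=
            expect_le_expect fun x _ => pow_four_norm_add_sub_le _ _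
        _ = 𝔼 x, ‖g x‖ ^ 4 + 6 * 𝔼 x, ‖g x‖ ^ 2 * ‖h x‖ ^ 2 + 𝔼 x, ‖h x‖ ^ 4 := by
            rw [expect_add_distrib, expect_add_distrib, mul_expect]
        _ ≤ (G + 3 * H) ^ 2 := by nlinarith [sq_nonneg H]

lemma card_hammingNorm_le (n d : ℕ) :
    #{ξ : Cube n | hammingNorm ξ ≤ d} ≤ chooseLE n d := by
  classical
  have hinj : Function.Injective fun ξ : Cube n => ({i | ξ i ≠ 0} : Finset (Fin n)) := by
    intro ξ η h
    ext i
    have := congrArg (i ∈ ·) h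
    simp only [mem_filter, mem_univ, true_and, eq_iff_iff] at this
    omega
  calc #{ξ : Cube n | hammingNorm ξ ≤ d}
      ≤ #((range (d + 1)).biUnion fun j => powersetCard j (univ : Finset (Fin n))) := by
        refine card_le_card_of_injOn _ (fun ξ hξ => ?_) hinj.injOn
        simp only [coe_biUnion, Set.mem_iUnion, mem_coe, mem_powersetCard, mem_range]
        exact ⟨hammingNorm ξ, by simpa [Nat.lt_succ_iff] using hξ, subset_univ _, rfl⟩
    _ ≤ ∑ j ∈ range (d + 1), #(powersetCard j (univ : Finset (Fin n))) := card_biUnion_le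
    _ = chooseLE n d := by simp [chooseLE]

/-! ### Moments of a function of bounded degree -/

lemma expect_norm_sq {n : ℕ} (p : Cube n → ℂ) : 𝔼 x, ‖p x‖ ^ 2 = ∑ ξ, ‖cubeFourier p ξ‖ ^ 2 := by
  simpa only [sum_cubeFourier_mul_cubeChar] using (expect_norm_sum_cubeChar (cubeFourier p)).1

lemma expect_norm_pow_four_le {n d : ℕ} {p : Cube n → ℂ} (hd : cubeDegree p ≤ d) :
    𝔼 x, ‖p x‖ ^ 4 ≤ 9 ^ d * (∑ ξ, ‖cubeFourier p ξ‖ ^ 2) ^ 2 := by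
  have h := (expect_norm_sum_cubeChar (cubeFourier p)).2
  simp only [sum_cubeFourier_mul_cubeChar] at h
  refine h.trans ?_
  have h1 : ∑ ξ, 3 ^ hammingNorm ξ * ‖cubeFourier p ξ‖ ^ 2 ≤
      3 ^ d * ∑ ξ, ‖cubeFourier p ξ‖ ^ 2 := by
    rw [mul_sum]
    refine sum_le_sum fun ξ _ => ?_
    by_cases hξ : d < hammingNorm ξ
    · simp [cubeDegree_le_iff.1 hd ξ hξ]
    · gcongr
      · norm_num
      · exact not_lt.1 hξ
  calc _ ≤ (3 ^ d * ∑ ξ, ‖cubeFourier p ξ‖ ^ 2) ^ 2 := by gcongr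
    _ = _ := by rw [mul_pow, ← pow_mul, mul_comm d, pow_mul]; norm_num

lemma inv_pow_le_expect_norm {n d : ℕ} {p : Cube n → ℂ} (hd : cubeDegree p ≤ d)
    (h1 : ∑ ξ, ‖cubeFourier p ξ‖ ^ 2 = 1) : ((3 : ℝ) ^ d)⁻¹ ≤ 𝔼 x, ‖p x‖ := by
  set κ : ℝ := ((3 : ℝ) ^ d)⁻¹ with hκ
  have hκ0 : 0 < κ := by positivity
  have h4 := expect_norm_pow_four_le hd
  have h9 : κ ^ 2 * 9 ^ d = 1 := by
    rw [hκ, inv_pow, ← pow_mul, mul_comm d, pow_mul]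
    norm_num
  rw [h1, one_pow, mul_one] at h4
  have h2 := expect_norm_sq p
  rw [h1] at h2
  have hpt (x : Cube n) : 3 * κ / 2 * ‖p x‖ ^ 2 ≤ ‖p x‖ + κ ^ 3 / 2 * ‖p x‖ ^ 4 := by
    have h0 := norm_nonneg (p x)
    -- This is `y³ - 3y + 2 = (y - 1)² (y + 2) ≥ 0` at `y = κ‖p x‖`, a pointwise substitute for
    -- Hölder between the first, second and fourth moments.
    have : 0 ≤ ‖p x‖ * ((κ * ‖p x‖ - 1) ^ 2 * (κ * ‖p x‖ + 2)) := by positivity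
    nlinarith
  have h := expect_le_expect (s := univ) fun x _ => hpt x
  rw [expect_add_distrib, ← mul_expect, ← mul_expect, h2] at h
  have : κ ^ 3 / 2 * 𝔼 x, ‖p x‖ ^ 4 ≤ κ / 2 := by
    calc _ ≤ κ ^ 3 / 2 * 9 ^ d := by gcongr
      _ = κ / 2 * (κ ^ 2 * 9 ^ d) := by ring
      _ = κ / 2 := by rw [h9, mul_one]
  linarith

lemma expect_norm_le_one {n : ℕ} {p : Cube n → ℂ} (h1 : ∑ ξ, ‖cubeFourier p ξ‖ ^ 2 = 1) :
    𝔼 x, ‖p x‖ ≤ 1 := by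
  have h := expect_le_expect (s := univ) fun x (_ : x ∈ univ) =>
    (by nlinarith [sq_nonneg (‖p x‖ - 1)] : ‖p x‖ ≤ (1 + ‖p x‖ ^ 2) / 2)
  rw [← expect_div, expect_add_distrib, Fintype.expect_one, expect_norm_sq, h1] at h
  linarith

lemma expect_truncated_le {n : ℕ} {p : Cube n → ℂ} (h1 : ∑ ξ, ‖cubeFourier p ξ‖ ^ 2 = 1)
    {κ : ℝ} (hκ : 0 < κ) : 𝔼 x, max (‖p x‖ - κ⁻¹) 0 ≤ κ / 4 := by
  have hpt (x : Cube n) : max (‖p x‖ - κ⁻¹) 0 ≤ κ / 4 * ‖p x‖ ^ 2 := by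
    refine max_le ?_ (by positivity)
    have : κ * κ⁻¹ = 1 := mul_inv_cancel₀ hκ.ne'
    have h0 : 0 ≤ κ * (‖p x‖ / 2 - κ⁻¹) ^ 2 := by positivity
    linear_combination h0 - (‖p x‖ - κ⁻¹) * this
  have h := expect_le_expect (s := univ) fun x _ => hpt x
  rwa [← mul_expect, expect_norm_sq, h1, mul_one] at h

/-! ### Uniform deviations over functions of bounded degree -/

lemma expect_ciSup_deviation_le {n d m : ℕ} (hm : 0 < m) {ι : Type*} [Finite ι] [Nonempty ι]
    (a : ι → Cube n → ℂ) (hd : ∀ p, cubeDegree (a p) ≤ d)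
    (h1 : ∀ p, ∑ ξ, ‖cubeFourier (a p) ξ‖ ^ 2 ≤ 1)
    {ψ : ℂ → ℝ} (hψ : ∀ z w, ψ z - ψ w ≤ ‖z - w‖) :
    𝔼 x : Fin m → Cube n, ⨆ p, ∑ i, (ψ (a p (x i)) - 𝔼 y, ψ (a p y)) ≤
      4 * √(chooseLE n d * m) := by
  have hN : 0 < chooseLE n d :=
    sum_pos' (fun _ _ => Nat.zero_le _) ⟨0, by simp⟩
  set s : ℝ := √(chooseLE n d * m)
  have hs : 0 < s := Real.sqrt_pos.2 (by positivity)
  have hs2 : s ^ 2 = chooseLE n d * m := Real.sq_sqrt (by positivity)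
  set W : (Fin m → Cube n × Fin 4) → Cube n → ℂ := fun w ξ =>
    ∑ i, Complex.I ^ ((w i).2 : ℕ) * cubeChar ξ (w i).1 with hW
  -- AM–GM with weight `s` replaces Cauchy–Schwarz, so that only second moments of `W` have to be
  -- averaged; `s² = N m` balances the two terms.
  have hsup (w : Fin m → Cube n × Fin 4) :
      ⨆ p, (∑ i, 4 * (Complex.I ^ ((w i).2 : ℕ) * a p (w i).1).re + 0) ≤
        2 * s + 2 / s * ∑ ξ with hammingNorm ξ ≤ d, ‖W w ξ‖ ^ 2 := by
    refine ciSup_le fun p => ?_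
    have hsum : ∑ i, Complex.I ^ ((w i).2 : ℕ) * a p (w i).1 =
        ∑ ξ with hammingNorm ξ ≤ d, cubeFourier (a p) ξ * W w ξ := by
      simp only [hW, mul_sum]
      rw [sum_comm]
      refine sum_congr rfl fun i _ => ?_
      rw [← sum_cubeFourier_mul_cubeChar (a p) (w i).1, mul_sum]
      symm
      refine sum_subset_zero_on_sdiff (subset_univ _) (fun ξ hξ => ?_) fun ξ _ => by ring
      simp only [mem_sdiff, mem_univ, mem_filter, true_and, not_le] at hξ
      simp [cubeDegree_le_iff.1 (hd p) ξ hξ]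
    have hterm (ξ : Cube n) : 4 * (cubeFourier (a p) ξ * W w ξ).re ≤
        2 * s * ‖cubeFourier (a p) ξ‖ ^ 2 + 2 / s * ‖W w ξ‖ ^ 2 := by
      have h2 := (Complex.re_le_norm (cubeFourier (a p) ξ * W w ξ)).trans_eq (norm_mul _ _)
      have h3 : 0 ≤ 2 / s * (s * ‖cubeFourier (a p) ξ‖ - ‖W w ξ‖) ^ 2 := by positivity
      have h4 : 2 / s * (s * ‖cubeFourier (a p) ξ‖ - ‖W w ξ‖) ^ 2 =
          2 * s * ‖cubeFourier (a p) ξ‖ ^ 2 + 2 / s * ‖W w ξ‖ ^ 2 -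
            4 * (‖cubeFourier (a p) ξ‖ * ‖W w ξ‖) := by
        field_simp; ring
      linarith
    rw [add_zero, ← mul_sum, ← Complex.re_sum, hsum, Complex.re_sum, mul_sum]
    calc _ ≤ ∑ ξ with hammingNorm ξ ≤ d,
          (2 * s * ‖cubeFourier (a p) ξ‖ ^ 2 + 2 / s * ‖W w ξ‖ ^ 2) :=
          sum_le_sum fun ξ _ => hterm ξ
      _ = 2 * s * ∑ ξ with hammingNorm ξ ≤ d, ‖cubeFourier (a p) ξ‖ ^ 2 +
          2 / s * ∑ ξ with hammingNorm ξ ≤ d, ‖W w ξ‖ ^ 2 := by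
          rw [sum_add_distrib, mul_sum, mul_sum]
      _ ≤ _ := by
          have : ∑ ξ with hammingNorm ξ ≤ d, ‖cubeFourier (a p) ξ‖ ^ 2 ≤ 1 :=
            (sum_le_univ_sum_of_nonneg fun _ => by positivity).trans (h1 p)
          refine add_le_add ?_ le_rfl
          exact mul_le_of_le_one_right (by positivity : 0 ≤ 2 * s) this
  have hmean (ξ : Cube n) : 𝔼 w, ‖W w ξ‖ ^ 2 = m := by
    simpa using expect_norm_sq_sum_phase (norm_cubeChar ξ) m 0
  calc _ ≤ 𝔼 w : Fin m → Cube n × Fin 4,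
        ⨆ p, (∑ i, 4 * (Complex.I ^ ((w i).2 : ℕ) * a p (w i).1).re + 0) := by
        simpa using expect_ciSup_sum_centered_le a hψ m fun _ => 0
    _ ≤ 𝔼 w : Fin m → Cube n × Fin 4,
        (2 * s + 2 / s * ∑ ξ with hammingNorm ξ ≤ d, ‖W w ξ‖ ^ 2) :=
        expect_le_expect fun w _ => hsup w
    _ = 2 * s + 2 / s * (#{ξ : Cube n | hammingNorm ξ ≤ d} * m) := by
        rw [expect_add_distrib, Fintype.expect_const, ← mul_expect, expect_sum_comm]
        simp [hmean]
    _ ≤ 2 * s + 2 / s * (chooseLE n d * m) := by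
        gcongr
        exact card_hammingNorm_le n d
    _ = 4 * s := by rw [← hs2]; field_simp; ring

open Classical in
/-- The samples on which some normalized function of degree at most `d` deviates are few. -/
lemma card_deviation_mul_le {n d m : ℕ} (hm : 0 < m) {ψ : ℂ → ℝ}
    (hψ : ∀ z w, ψ z - ψ w ≤ ‖z - w‖) (t : ℝ) :
    #{x : Fin m → Cube n | ∃ p : Cube n → ℂ, cubeDegree p ≤ d ∧
        ∑ ξ, ‖cubeFourier p ξ‖ ^ 2 ≤ 1 ∧ t < ∑ i, (ψ (p (x i)) - 𝔼 y, ψ (p y))} * t ≤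
      4 * √(chooseLE n d * m) * Fintype.card (Fin m → Cube n) := by
  set B : Finset (Fin m → Cube n) := {x | ∃ p : Cube n → ℂ, cubeDegree p ≤ d ∧
        ∑ ξ, ‖cubeFourier p ξ‖ ^ 2 ≤ 1 ∧ t < ∑ i, (ψ (p (x i)) - 𝔼 y, ψ (p y))} with hB
  have hz : ∀ ξ, cubeFourier (fun _ : Cube n => (0 : ℂ)) ξ = 0 := fun ξ => by simp [cubeFourier]
  have hz0 : cubeDegree (fun _ : Cube n => (0 : ℂ)) ≤ d := cubeDegree_le_iff.2 fun ξ _ => hz ξ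
  -- Only finitely many samples exist, so one witness per bad sample gives a finite family.
  -- Adjoining the zero function makes the supremum nonnegative, as Markov's inequality requires.
  have hch (x : Fin m → Cube n) : ∃ p : Cube n → ℂ, cubeDegree p ≤ d ∧
      ∑ ξ, ‖cubeFourier p ξ‖ ^ 2 ≤ 1 ∧
        (x ∈ B → t < ∑ i, (ψ (p (x i)) - 𝔼 y, ψ (p y))) := by
    by_cases hx : x ∈ B
    · obtain ⟨p, h1, h2, h3⟩ := (mem_filter.1 hx).2
      exact ⟨p, h1, h2, fun _ => h3⟩
    · exact ⟨fun _ => 0, hz0, by simp [hz], fun h => absurd h hx⟩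
  choose P hP1 hP2 hP3 using hch
  set a : Option (Fin m → Cube n) → Cube n → ℂ := fun o => o.elim (fun _ => 0) P
  have h := expect_ciSup_deviation_le (d := d) hm a
    (fun o => by cases o with | none => exact hz0 | some x => exact hP1 x)
    (fun o => by cases o with | none => simp [a, hz] | some x => exact hP2 x) hψ
  have hle (x : Fin m → Cube n) (o : Option (Fin m → Cube n)) :
      ∑ i, (ψ (a o (x i)) - 𝔼 y, ψ (a o y)) ≤ ⨆ o, ∑ i, (ψ (a o (x i)) - 𝔼 y, ψ (a o y)) :=
    le_ciSup (f := fun o => ∑ i, (ψ (a o (x i)) - 𝔼 y, ψ (a o y)))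
      (Set.finite_range _).bddAbove o
  rw [Fintype.expect_eq_sum_div_card, div_le_iff₀ (by exact_mod_cast Fintype.card_pos)] at h
  refine le_trans ?_ h
  rw [← nsmul_eq_mul, ← sum_const]
  calc ∑ _x ∈ B, t ≤ ∑ x ∈ B, ⨆ o, ∑ i, (ψ (a o (x i)) - 𝔼 y, ψ (a o y)) :=
        sum_le_sum fun x hx => (hP3 x hx).le.trans (hle x (some x))
    _ ≤ _ := sum_le_univ_sum_of_nonneg fun x => le_trans (by simp [a]) (hle x none)

/-! ### From small deviations to the three inequalities -/

/-- The values `a i` have average close to `A`, and their excesses over `κ⁻¹` have a small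
average; then no few of them carry almost half of the sum. -/
lemma sum_subset_bounds {m : ℕ} {a : Fin m → ℝ} {A κ δ : ℝ} (hκ : 0 < κ) (hκA : κ ≤ A) (hA : A ≤ 1)
    (hδ : 0 < δ) (hlo : m * (A - δ / κ) ≤ ∑ i, a i) (hhi : ∑ i, a i ≤ m * (A + δ / κ))
    (htr : ∑ i, max (a i - κ⁻¹) 0 ≤ m * (κ / 4 + δ / κ)) {S : Finset (Fin m)}
    (hS : (#S : ℝ) ≤ (κ ^ 2 / 4 - 8 * δ) * m) :
    ∑ i ∈ S, a i ≤ (1 / 2 - δ) * ∑ i, a i ∧ ∑ i ∈ S, a i + δ * m * A ≤ ∑ i ∈ Sᶜ, a i := by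
  have hT : ∑ i ∈ S, a i ≤ m * (κ / 2 - 7 * (δ / κ)) := by
    calc ∑ i ∈ S, a i ≤ ∑ i ∈ S, (κ⁻¹ + max (a i - κ⁻¹) 0) :=
          sum_le_sum fun i _ => by linarith [le_max_left (a i - κ⁻¹) 0]
      _ = #S * κ⁻¹ + ∑ i ∈ S, max (a i - κ⁻¹) 0 := by
          rw [sum_add_distrib, sum_const, nsmul_eq_mul]
      _ ≤ ((κ ^ 2 / 4 - 8 * δ) * m) * κ⁻¹ + m * (κ / 4 + δ / κ) := by
          gcongr
          exact (sum_le_univ_sum_of_nonneg fun _ => le_max_right _ _).trans htr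
      _ = m * (κ / 2 - 7 * (δ / κ)) := by field_simp; ring
  have hsplit : ∑ i ∈ S, a i + ∑ i ∈ Sᶜ, a i = ∑ i, a i := sum_add_sum_compl S a
  have hκ1 : κ ≤ 1 := hκA.trans hA
  rcases m.eq_zero_or_pos with rfl | hm
  · have : S = ∅ := Subsingleton.elim _ _
    subst this
    simp
  have hm' : (0 : ℝ) < m := by exact_mod_cast hm
  -- For `m > 0`, the existence of an admissible `S` already forces `8 δ ≤ κ² / 4`.
  have hδ1 : δ ≤ 1 := by
    have h1 : 0 ≤ (κ ^ 2 / 4 - 8 * δ) * m := (Nat.cast_nonneg _).trans hS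
    have h2 : 0 ≤ κ ^ 2 / 4 - 8 * δ := nonneg_of_mul_nonneg_left h1 hm'
    nlinarith
  have hε : δ ≤ δ / κ := le_div_self hδ.le hκ hκ1
  have hδA : δ * A ≤ δ / κ := (mul_le_of_le_one_right hδ.le hA).trans hε
  have hδε : δ * (δ / κ) ≤ δ / κ := mul_le_of_le_one_left (by positivity) hδ1
  constructor
  · have h1 : δ * ∑ i, a i ≤ m * (2 * (δ / κ)) := by
      calc δ * ∑ i, a i ≤ δ * (m * (A + δ / κ)) := by gcongr
        _ = m * (δ * A + δ * (δ / κ)) := by ring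
        _ ≤ m * (2 * (δ / κ)) := by gcongr; linarith
    have h2 : (m : ℝ) * (κ / 2 - 7 * (δ / κ)) ≤ m * ((A - δ / κ) / 2 - 2 * (δ / κ)) := by
      have : 0 ≤ δ / κ := by positivity
      exact mul_le_mul_of_nonneg_left (by linarith) hm'.le
    linarith
  · have h2 : (m : ℝ) * (2 * (κ / 2 - 7 * (δ / κ)) + δ * A) ≤ m * (A - δ / κ) := by
      have : 0 ≤ δ / κ := by positivity
      exact mul_le_mul_of_nonneg_left (by linarith) hm'.le
    linarith

/-- All three inequalities are homogeneous in `p`, and the third follows from the second since `𝔼‖q‖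
≥ 3⁻ᵈ` for normalized `q`. -/
lemma isEuclideanSection_of_normalized {n m d : ℕ} {δ ρ : ℝ} {x : Fin m → Cube n} (hδ : 0 < δ)
    (h : ∀ p : Cube n → ℂ, cubeDegree p ≤ d → ∑ ξ, ‖cubeFourier p ξ‖ ^ 2 = 1 →
      ∀ S : Finset (Fin m), (S.card : ℝ) ≤ ρ * m →
        ∑ i ∈ S, ‖p (x i)‖ ≤ (1 / 2 - δ) * ∑ i, ‖p (x i)‖ ∧
        ∑ i ∈ S, ‖p (x i)‖ + δ * m * 𝔼 y, ‖p y‖ ≤ ∑ i ∈ Sᶜ, ‖p (x i)‖) :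
    IsEuclideanSection d δ ρ x := by
  intro p hp S hS
  rcases (Real.sqrt_nonneg (∑ ξ, ‖cubeFourier p ξ‖ ^ 2)).eq_or_lt with h0 | hpos
  · have h1 : ∀ ξ, cubeFourier p ξ = 0 := by
      have := (Real.sqrt_eq_zero (by positivity)).1 h0.symm
      rw [sum_eq_zero_iff_of_nonneg fun _ _ => by positivity] at this
      exact fun ξ => by simpa using this ξ (mem_univ _)
    have h2 : ∀ y, p y = 0 := fun y => by
      rw [← sum_cubeFourier_mul_cubeChar p y]
      simp [h1]
    simp [h2, cubeFourierL2, h1]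
  · set L : ℝ := √(∑ ξ, ‖cubeFourier p ξ‖ ^ 2) with hL
    set q : Cube n → ℂ := fun y => (L⁻¹ : ℝ) * p y with hq
    have hq1 : ∑ ξ, ‖cubeFourier q ξ‖ ^ 2 = 1 := by
      simp only [hq, cubeFourier_smul, norm_mul, mul_pow, ← mul_sum, Complex.norm_real,
        Real.norm_eq_abs, sq_abs]
      rw [← Real.sq_sqrt (show 0 ≤ ∑ ξ, ‖cubeFourier p ξ‖ ^ 2 by positivity), ← hL]
      field_simp
    have hqd : cubeDegree q ≤ d := cubeDegree_le_iff.2 fun ξ hξ => by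
      rw [hq, cubeFourier_smul, cubeDegree_le_iff.1 hp ξ hξ, mul_zero]
    have hpq (y : Cube n) : ‖p y‖ = L * ‖q y‖ := by
      simp only [hq, norm_mul, Complex.norm_real, Real.norm_eq_abs, abs_of_pos (inv_pos.2 hpos)]
      field_simp
    obtain ⟨h1, h2⟩ := h q hqd hq1 S hS
    have h3 := inv_pow_le_expect_norm hqd hq1
    have hm : (0 : ℝ) ≤ m := Nat.cast_nonneg m
    simp only [hpq, ← mul_sum, ← mul_expect]
    refine ⟨?_, ?_, ?_⟩
    · linarith [mul_le_mul_of_nonneg_left h1 hpos.le]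
    · linarith [mul_le_mul_of_nonneg_left h2 hpos.le]
    · have h4 : δ * m * L * ((3 : ℝ) ^ d)⁻¹ ≤ δ * m * L * 𝔼 y, ‖q y‖ := by gcongr
      have h5 : cubeFourierL2 p = L := rfl
      rw [h5]
      linarith [mul_le_mul_of_nonneg_left h2 hpos.le]

lemma isEuclideanSection_of_deviation_le {n m d : ℕ} {δ : ℝ} {x : Fin m → Cube n} (hδ : 0 < δ)
    (h : ∀ p : Cube n → ℂ, cubeDegree p ≤ d → ∑ ξ, ‖cubeFourier p ξ‖ ^ 2 ≤ 1 →
      ∑ i, (-‖p (x i)‖ - 𝔼 y, -‖p y‖) ≤ m * (3 ^ d * δ) ∧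
      ∑ i, (‖p (x i)‖ - 𝔼 y, ‖p y‖) ≤ m * (3 ^ d * δ) ∧
      ∑ i, (max (‖p (x i)‖ - 3 ^ d) 0 - 𝔼 y, max (‖p y‖ - 3 ^ d) 0) ≤ m * (3 ^ d * δ)) :
    IsEuclideanSection d δ (1 / (4 * 3 ^ (2 * d)) - 8 * δ) x := by
  refine isEuclideanSection_of_normalized hδ fun p hp h1 S hS => ?_
  obtain ⟨hlo, hhi, htr⟩ := h p hp h1.le
  rw [sum_sub_distrib, sum_const, card_univ, Fintype.card_fin, nsmul_eq_mul] at hlo hhi htr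
  rw [expect_neg_distrib, sum_neg_distrib] at hlo
  set κ : ℝ := ((3 : ℝ) ^ d)⁻¹ with hκ
  have hκ' : δ / κ = 3 ^ d * δ := by rw [hκ, div_inv_eq_mul, mul_comm]
  have hκ0 : 0 < κ := by positivity
  have htm := expect_truncated_le h1 hκ0
  refine sum_subset_bounds hκ0 (inv_pow_le_expect_norm hp h1) (expect_norm_le_one h1) hδ
    ?_ ?_ ?_ ?_
  · rw [hκ']; linarith
  · rw [hκ']; linarith
  · rw [hκ']
    rw [show κ⁻¹ = 3 ^ d from inv_inv _] at htm ⊢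
    have : (m : ℝ) * 𝔼 y, max (‖p y‖ - 3 ^ d) 0 ≤ m * (κ / 4) := by gcongr
    linarith
  · have : κ ^ 2 / 4 = 1 / (4 * 3 ^ (2 * d)) := by
      rw [hκ, inv_pow, ← pow_mul, mul_comm d]; field_simp
    rwa [this]

/-! ### The sampling measure -/

lemma samplePoints_real_coe (n m : ℕ) (s : Finset (Fin m → Cube n)) :
    (samplePoints n m).real (s : Set (Fin m → Cube n)) =
      #s / Fintype.card (Fin m → Cube n) := by
  classical
  have h : samplePoints n m = uniformOn (Set.univ : Set (Fin m → Cube n)) := by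
    rw [samplePoints, ← uniformOn_pi, Set.pi_univ]
  rw [h, Measure.real, uniformOn_univ, Measure.count_apply_finset]
  simp

/-- A union bound over the three deviation events, each of probability at most `1/300`. -/
lemma le_samplePoints_real {n m : ℕ} {P Q₁ Q₂ Q₃ : (Fin m → Cube n) → Prop}
    (hP : ∀ x, ¬ Q₁ x → ¬ Q₂ x → ¬ Q₃ x → P x)
    [DecidablePred Q₁] [DecidablePred Q₂] [DecidablePred Q₃]
    (h₁ : (#{x | Q₁ x} : ℝ) ≤ Fintype.card (Fin m → Cube n) / 300)
    (h₂ : (#{x | Q₂ x} : ℝ) ≤ Fintype.card (Fin m → Cube n) / 300)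
    (h₃ : (#{x | Q₃ x} : ℝ) ≤ Fintype.card (Fin m → Cube n) / 300) :
    0.99 ≤ (samplePoints n m).real {x | P x} := by
  classical
  have hcoe : {x | P x} = ((univ.filter P : Finset (Fin m → Cube n)) : Set _) := by simp
  have hpos : (0 : ℝ) < Fintype.card (Fin m → Cube n) := by exact_mod_cast Fintype.card_pos
  rw [hcoe, samplePoints_real_coe, le_div_iff₀ hpos]
  have hcov : Fintype.card (Fin m → Cube n) ≤
      #(univ.filter P) + (#(univ.filter Q₁) + (#(univ.filter Q₂) + #(univ.filter Q₃))) := by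
    rw [← card_univ]
    refine (card_le_card (t := univ.filter P ∪ (univ.filter Q₁ ∪ (univ.filter Q₂ ∪
      univ.filter Q₃))) fun x _ => ?_).trans ((card_union_le _ _).trans
      (by gcongr; exact (card_union_le _ _).trans (by gcongr; exact card_union_le _ _)))
    simp only [mem_union, mem_filter, mem_univ, true_and]
    by_contra hc
    push Not at hc
    exact hc.1 (hP x hc.2.1 hc.2.2.1 hc.2.2.2)
  have hcov' : (Fintype.card (Fin m → Cube n) : ℝ) ≤
      #(univ.filter P) + (#(univ.filter Q₁) + (#(univ.filter Q₂) + #(univ.filter Q₃))) := by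
    exact_mod_cast hcov
  linarith

/-! ### Binomial estimates -/

/-- For `n < 2d` the full sum `2ⁿ` is already below `4ᵈ`; otherwise the binomials increase up to
`d`, and `d + 1 ≤ 4ᵈ`. -/
lemma chooseLE_le_four_pow_mul {n d : ℕ} (hdn : d < n) :
    chooseLE n d ≤ 4 ^ d * n.choose d := by
  rcases Nat.lt_or_ge n (2 * d) with h | h
  · calc chooseLE n d ≤ ∑ j ∈ range (n + 1), n.choose j :=
          sum_le_sum_of_subset (range_subset_range.2 (by omega))
      _ = 2 ^ n := Nat.sum_range_choose n
      _ ≤ 2 ^ (2 * d) := Nat.pow_le_pow_right (by norm_num) h.le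
      _ = 4 ^ d := by rw [pow_mul]; norm_num
      _ ≤ 4 ^ d * n.choose d := Nat.le_mul_of_pos_right _ (Nat.choose_pos hdn.le)
  · have hmono (j : ℕ) (hj : j ≤ d) : n.choose j ≤ n.choose d := by
      induction d, hj using Nat.le_induction with
      | base => exact le_rfl
      | succ k _ ih =>
        exact (ih (by omega) (by omega)).trans (Nat.choose_le_succ_of_lt_half_left (by omega))
    calc chooseLE n d ≤ ∑ _j ∈ range (d + 1), n.choose d :=
          sum_le_sum fun j hj => hmono j (Nat.lt_succ_iff.1 (mem_range.1 hj))
      _ = (d + 1) * n.choose d := by simp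
      _ ≤ 4 ^ d * n.choose d := by
          gcongr
          exact d.lt_pow_self (by norm_num)

lemma two_le_choose {n d : ℕ} (hd : 0 < d) (hdn : d < n) : 2 ≤ n.choose d := by
  have := Nat.choose_pos (n := n) (k := d) hdn.le
  have h1 : n.choose d ≠ 1 := by rw [Ne, Nat.choose_eq_one_iff]; omega
  omega

lemma two_le_chooseLE {n d : ℕ} (hd : 0 < d) (hn : 0 < n) : 2 ≤ chooseLE n d := by
  calc 2 ≤ ∑ j ∈ range 2, n.choose j := by simp [sum_range_succ]; omega
    _ ≤ chooseLE n d := sum_le_sum_of_subset (range_subset_range.2 (by omega))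

lemma half_le_log {k : ℕ} (hk : 2 ≤ k) : (1 / 2 : ℝ) ≤ Real.log k := by
  have h := Real.log_le_log (by norm_num) (show (2 : ℝ) ≤ k by exact_mod_cast hk)
  linarith [Real.log_two_gt_d9]

/-- The sample size is at least a constant times `binom(n, ≤ d) / (9 ^ d δ ^ 2)`. -/
lemma chooseLE_le_of_sample_size {n d m : ℕ} {δ C : ℝ} (hδ : 0 < δ) (hC : 0 < C) (hd : 0 < d)
    (hn : 0 < n)
    (h : (d < n ∧ 2 * C * (n.choose d : ℝ) * Real.log (n.choose d : ℝ) / δ ^ 2 ≤ (m : ℝ)) ∨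
        2 * C * (chooseLE n d : ℝ) * Real.log (chooseLE n d : ℝ) / δ ^ 2 ≤ (m : ℝ)) :
    C * chooseLE n d ≤ m * (3 ^ d * δ) ^ 2 := by
  have hlog {k : ℕ} (hk : 2 ≤ k)
      (h : 2 * C * (k : ℝ) * Real.log (k : ℝ) / δ ^ 2 ≤ (m : ℝ)) : C * k ≤ m * δ ^ 2 := by
    rw [div_le_iff₀ (by positivity)] at h
    refine le_trans ?_ h
    nlinarith [mul_le_mul_of_nonneg_left (half_le_log hk) (show 0 ≤ 2 * C * (k : ℝ) by positivity)]
  have h9 : ((3 : ℝ) ^ d) ^ 2 = 9 ^ d := by rw [← pow_mul, mul_comm, pow_mul]; norm_num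
  rw [mul_pow, h9]
  rcases h with ⟨hdn, h⟩ | h
  · have h1 := hlog (two_le_choose hd hdn) h
    have h2 : (chooseLE n d : ℝ) ≤ 4 ^ d * n.choose d := by
      exact_mod_cast chooseLE_le_four_pow_mul hdn
    calc C * chooseLE n d ≤ C * (4 ^ d * n.choose d) := by gcongr
      _ = 4 ^ d * (C * n.choose d) := by ring
      _ ≤ 9 ^ d * (m * δ ^ 2) := by gcongr; norm_num
      _ = m * (9 ^ d * δ ^ 2) := by ring
  · have h1 := hlog (two_le_chooseLE hd hn) h
    have h2 : (1 : ℝ) ≤ 9 ^ d := one_le_pow₀ (by norm_num)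
    have h3 : (0 : ℝ) ≤ m * δ ^ 2 := by positivity
    nlinarith

/-- A function of degree at most `d` is constant if `d = 0` or `n = 0`. -/
lemma eq_of_cubeDegree_le_zero {n d : ℕ} (h0 : d = 0 ∨ n = 0) {p : Cube n → ℂ}
    (hp : cubeDegree p ≤ d) (x y : Cube n) : p x = p y := by
  rcases h0 with rfl | rfl
  · rw [← sum_cubeFourier_mul_cubeChar p x, ← sum_cubeFourier_mul_cubeChar p y]
    refine sum_congr rfl fun ξ _ => ?_
    rcases (hammingNorm ξ).eq_zero_or_pos with h | h
    · simp [hammingNorm_eq_zero.1 h, cubeChar]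
    · simp [cubeDegree_le_iff.1 hp ξ h]
  · rw [Subsingleton.elim x y]

/-! ### The theorem -/

theorem mainTheorem9 :
    ∃ C : ℝ, 0 < C ∧ ∀ (n d : ℕ) (δ : ℝ), 0 < δ → ∀ m : ℕ,
      ((d < n ∧ C * (n.choose d : ℝ) * Real.log (n.choose d : ℝ) / δ ^ 2 ≤ (m : ℝ)) ∨
        C * (chooseLE n d : ℝ) * Real.log (chooseLE n d : ℝ) / δ ^ 2 ≤ (m : ℝ)) →
      0.99 ≤ (samplePoints n m).real
        {x | IsEuclideanSection d δ (1 / (4 * 3 ^ (2 * d)) - 8 * δ) x} := by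
  classical
  -- `1200 = 4 · 300`: the constant of the expected supremum over the failure probability `1/300`.
  -- The factor 2 compensates for `log ≥ 1/2`.
  refine ⟨2 * 1200 ^ 2, by norm_num, fun n d δ hδ m hm => ?_⟩
  -- Here the logarithm can vanish and leave `m` unconstrained, but `p` is constant, so every
  -- deviation is zero.
  by_cases h0 : d = 0 ∨ n = 0
  · refine le_samplePoints_real (Q₁ := fun _ => False) (Q₂ := fun _ => False)
      (Q₃ := fun _ => False) (fun x _ _ _ => ?_) (by simp; positivity)
      (by simp; positivity) (by simp; positivity)
    refine isEuclideanSection_of_deviation_le hδ fun p hp _ => ?_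
    have hψ (ψ : ℂ → ℝ) : ∑ i, (ψ (p (x i)) - 𝔼 y, ψ (p y)) ≤ m * (3 ^ d * δ) := by
      refine le_trans (le_of_eq (sum_eq_zero fun i _ => ?_)) (by positivity)
      rw [expect_congr rfl fun y _ => congrArg ψ (eq_of_cubeDegree_le_zero h0 hp y (x i)),
        Fintype.expect_const, sub_self]
    exact ⟨hψ fun z => -‖z‖, hψ fun z => ‖z‖, hψ fun z => max (‖z‖ - 3 ^ d) 0⟩
  push Not at h0
  have hN := chooseLE_le_of_sample_size hδ (by norm_num) (Nat.pos_of_ne_zero h0.1)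
    (Nat.pos_of_ne_zero h0.2) hm
  have hN1 : (2 : ℝ) ≤ chooseLE n d := by
    exact_mod_cast two_le_chooseLE (Nat.pos_of_ne_zero h0.1) (Nat.pos_of_ne_zero h0.2)
  have hmpos : 0 < m := by
    rcases m.eq_zero_or_pos with rfl | h
    · norm_num at hN; linarith
    · exact h
  set t : ℝ := m * (3 ^ d * δ) with ht
  have ht0 : 0 < t := by positivity
  have hsq : 1200 * √(chooseLE n d * m) ≤ t := by
    refine le_of_sq_le_sq ?_ ht0.le
    rw [mul_pow, Real.sq_sqrt (by positivity), ht]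
    calc (1200 : ℝ) ^ 2 * (chooseLE n d * m) = 1200 ^ 2 * chooseLE n d * m := by ring
      _ ≤ m * (3 ^ d * δ) ^ 2 * m := by gcongr
      _ = (m * (3 ^ d * δ)) ^ 2 := by ring
  have hcard {ψ : ℂ → ℝ} (hψ : ∀ z w, ψ z - ψ w ≤ ‖z - w‖) :
      (#{x : Fin m → Cube n | ∃ p : Cube n → ℂ, cubeDegree p ≤ d ∧
        ∑ ξ, ‖cubeFourier p ξ‖ ^ 2 ≤ 1 ∧ t < ∑ i, (ψ (p (x i)) - 𝔼 y, ψ (p y))} : ℝ) ≤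
      Fintype.card (Fin m → Cube n) / 300 := by
    have h := card_deviation_mul_le (n := n) (d := d) hmpos hψ t
    refine le_of_mul_le_mul_right (h.trans ?_) ht0
    calc _ = 1200 * √(chooseLE n d * m) * (Fintype.card (Fin m → Cube n) / 300) := by ring
      _ ≤ t * (Fintype.card (Fin m → Cube n) / 300) := by gcongr
      _ = _ := mul_comm _ _
  refine le_samplePoints_real (fun x h₁ h₂ h₃ => ?_)
    (hcard (ψ := fun z => -‖z‖) fun z w => ?_) (hcard (ψ := fun z => ‖z‖) fun z w => ?_)
    (hcard (ψ := fun z => max (‖z‖ - 3 ^ d) 0) fun z w => ?_)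
  · push Not at h₁ h₂ h₃
    exact isEuclideanSection_of_deviation_le hδ fun p hp h1 =>
      ⟨h₁ p hp h1, h₂ p hp h1, h₃ p hp h1⟩
  · have := norm_sub_norm_le w z
    rw [norm_sub_rev] at this
    linarith
  · exact norm_sub_norm_le z w
  · have h1 := norm_sub_norm_le z w
    have h2 := norm_nonneg (z - w)
    rw [sub_le_iff_le_add']
    refine max_le ?_ ?_
    · linarith [le_max_left (‖w‖ - 3 ^ d) 0]
    · linarith [le_max_right (‖w‖ - 3 ^ d) 0]
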